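/- Let $\mathbb U=\{z\in\mathbb C:|z|<1\}$ and $\hat{\mathbb C}=\mathbb C\cup\{\infty\}$. Let $H^2$ be the Hilbert space of functions $f(z)=\sum_{n\ge 0}\hat f(n)z^n$ holomorphic on $\mathbb U$ with $\|f\|^2=\sum_n|\hat f(n)|^2<\infty$ and inner product $\langle f,g\rangle=\sum_n \hat f(n)\overline{\hat g(n)}$. Let $\rho(z)=1/\overline z$ be inversion in the unit circle on $\hat{\mathbb C}$, with $\rho(0)=\infty$ and $\rho(\infty)=0$. The degree of a rational function is the larger of the degrees of its numerator and denominator in lowest terms. A point $w\in\hat{\mathbb C}$ is a regular value of a rational function $R$ of degree $d$ if $R^{-1}(\{w\})\subset\hat{\mathbb C}$ has exactly $d$ distinct points. A branch of $R^{-1}$ on an open set $\Omega\subset\hat{\mathbb C}$ is the inverse $\sigma:\Omega\to V_1$ of the restriction of $R$ to an open set $V_1\subset\hat{\mathbb C}$ that $R$ maps injectively onto $\Omega$. Let $\varphi$ be a rational function of degree $d>0$ with $\varphi(\mathbb U)\subset\mathbb U$, and put $\varphi_e=\rho\circ\varphi\circ\rho$. Then the composition operator $C_\varphi f=f\circ\varphi$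 is a bounded operator on $H^2$, and its adjoint $C_\varphi^*$ is given as follows. Let $f\in H^2$, let $z_0\in\mathbb U$ be a regular value of $\varphi_e$, and let $V\subset\mathbb U$ be any connected open neighborhood of $z_0$ on which there are defined $d$ distinct branches $\sigma_1,\dots,\sigma_d$ of $\varphi_e^{-1}$. Each $\sigma_j$ is holomorphic on $V$ with values in $\mathbb U$, and: (a) If $\varphi(\infty)\ne\infty$, then for all $z\in V\setminus\{1/\overline{\varphi(\infty)}\}$ (where $1/\overline{0}$ means $\infty$, so that nothing is removed if $\varphi(\infty)=0$) the denominators below are nonzero and $$C_\varphi^*f(z)=\frac{f(0)}{1-\overline{\varphi(\infty)}\,z}+z\sum_{j=1}^d\frac{\sigma_j'(z)}{\sigma_j(z)}\,f(\sigma_j(z)).$$ (b) If $\varphi(\infty)=\infty$, then for all $z\in V\setminus\{0\}$ the denominators below are nonzero and $$C_\varphi^*f(z)=z\sum_{j=1}^d\frac{\sigma_j'(z)}{\sigma_j(z)}\,f(\sigma_j(z)),$$ while $C_\varphi^*f(0)=f(0)$ if $0\in V$. -/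

import Mathlib

namespace RatComp

/-! ### The Hardy space `H²` of the unit disc -/

/-- The `n`-th Maclaurin coefficient of a function holomorphic near `0`. -/
noncomputable def maclaurin (f : ℂ → ℂ) (n : ℕ) : ℂ :=
  iteratedDeriv n f 0 / (n.factorial : ℂ)

/-- A function on the open unit disc is represented by its extension by `0` to the whole plane. The
property says that it is holomorphic on the disc and has square-summable Maclaurin coefficients. -/
structure IsHardy (f : ℂ → ℂ) : Prop where
  holo : DifferentiableOn ℂ f (Metric.ball 0 1)
  supp : ∀ z, z ∉ Metric.ball (0 : ℂ) 1 → f z = 0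
  sq_summable : Summable fun n => ‖maclaurin f n‖ ^ 2

theorem analyticAt_zero {f : ℂ → ℂ} (hf : DifferentiableOn ℂ f (Metric.ball 0 1)) :
    AnalyticAt ℂ f 0 :=
  hf.analyticAt (Metric.isOpen_ball.mem_nhds (by simp))

theorem maclaurin_add {f g : ℂ → ℂ} (hf : DifferentiableOn ℂ f (Metric.ball 0 1))
    (hg : DifferentiableOn ℂ g (Metric.ball 0 1)) (n : ℕ) :
    maclaurin (f + g) n = maclaurin f n + maclaurin g n := by
  unfold maclaurin
  rw [iteratedDeriv_add (analyticAt_zero hf).contDiffAt (analyticAt_zero hg).contDiffAt, add_div]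

theorem maclaurin_smul (c : ℂ) (f : ℂ → ℂ) (n : ℕ) :
    maclaurin (c • f) n = c * maclaurin f n := by
  unfold maclaurin
  rw [iteratedDeriv_const_smul_field, smul_eq_mul, mul_div_assoc]

theorem memlp_of_sq {a : ℕ → ℂ} (h : Summable fun n => ‖a n‖ ^ 2) : Memℓp a 2 :=
  memℓp_gen (by simpa using h)

theorem sq_of_memlp {a : ℕ → ℂ} (h : Memℓp a 2) : Summable fun n => ‖a n‖ ^ 2 := by
  simpa using h.summable (by norm_num)

theorem maclaurin_zero (n : ℕ) : maclaurin 0 n = 0 := by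
  simpa using maclaurin_smul 0 0 n

/-- The complex vector space of all such functions. -/
noncomputable def hardySubmodule : Submodule ℂ (ℂ → ℂ) where
  carrier := {f | IsHardy f}
  zero_mem' := ⟨differentiableOn_const 0, fun _ _ => rfl, by simp [maclaurin_zero]⟩
  add_mem' := by
    intro f g hf hg
    refine ⟨hf.holo.add hg.holo, fun z hz => by simp [hf.supp z hz, hg.supp z hz], ?_⟩
    have h := sq_of_memlp ((memlp_of_sq hf.sq_summable).add (memlp_of_sq hg.sq_summable))
    refine h.congr fun n => ?_
    rw [maclaurin_add hf.holo hg.holo]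
    rfl
  smul_mem' := by
    intro c f hf
    refine ⟨hf.holo.const_smul c, fun z hz => by simp [hf.supp z hz], ?_⟩
    have h := hf.sq_summable.mul_left (‖c‖ ^ 2)
    refine h.congr fun n => ?_
    rw [maclaurin_smul, norm_mul, mul_pow]

/-- The Hardy space `H²` of the open unit disc. -/
def H2 : Type := hardySubmodule

namespace H2

noncomputable instance : AddCommGroup H2 := inferInstanceAs (AddCommGroup hardySubmodule)

noncomputable instance : Module ℂ H2 := inferInstanceAs (Module ℂ hardySubmodule)

instance : CoeFun H2 (fun _ => ℂ → ℂ) := ⟨fun f => f.1⟩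

theorem isHardy (f : H2) : IsHardy f := f.2

/-- The sequence of Maclaurin coefficients, as an element of `ℓ²`. -/
noncomputable def coeffs : H2 →ₗ[ℂ] lp (fun _ : ℕ => ℂ) 2 where
  toFun f := ⟨maclaurin f, memlp_of_sq f.isHardy.sq_summable⟩
  map_add' f g := by
    ext n
    exact maclaurin_add f.isHardy.holo g.isHardy.holo n
  map_smul' c f := by
    ext n
    exact maclaurin_smul c f n

theorem coeffs_apply (f : H2) (n : ℕ) : coeffs f n = maclaurin f n := rfl

theorem hasSum (f : H2) {z : ℂ} (hz : z ∈ Metric.ball (0 : ℂ) 1) :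
    HasSum (fun n => maclaurin f n * z ^ n) (f z) := by
  have h := Complex.hasSum_taylorSeries_on_ball f.isHardy.holo hz
  refine h.congr_fun ?_ |> fun h => h
  intro n
  simp only [maclaurin, sub_zero, smul_eq_mul]
  ring

theorem coeffs_injective : Function.Injective coeffs := by
  intro f g h
  refine Subtype.ext (funext fun z => ?_)
  by_cases hz : z ∈ Metric.ball (0 : ℂ) 1
  · refine (f.hasSum hz).unique ((g.hasSum hz).congr_fun fun n => ?_)
    rw [← coeffs_apply, h, coeffs_apply]
  · exact (f.isHardy.supp z hz).trans (g.isHardy.supp z hz).symm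

theorem coeffs_surjective : Function.Surjective coeffs := by
  classical
  intro a
  have hbd : ∀ n, ‖a n‖ ≤ ‖a‖ := fun n => lp.norm_apply_le_norm (by norm_num) a n
  set p := FormalMultilinearSeries.ofScalars ℂ (fun n => a n) with hp
  have hrad : 1 ≤ p.radius := by
    have := p.le_radius_of_bound (r := 1) ‖a‖ (fun n => by
      rw [hp, FormalMultilinearSeries.ofScalars_norm]; simpa using hbd n)
    simpa using this
  have hball : HasFPowerSeriesOnBall p.sum p 0 1 :=
    (p.hasFPowerSeriesOnBall (lt_of_lt_of_le one_pos hrad)).mono one_pos hrad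
  have hb1 : Metric.eball (0 : ℂ) 1 = Metric.ball 0 1 := by
    rw [← ENNReal.ofReal_one, Metric.eball_ofReal]
  let F : ℂ → ℂ := fun z => if z ∈ Metric.ball (0 : ℂ) 1 then p.sum z else 0
  have hF : HasFPowerSeriesOnBall F p 0 1 := hball.congr (fun z hz => by
    rw [hb1] at hz
    exact (if_pos hz).symm)
  have hd : DifferentiableOn ℂ F (Metric.ball 0 1) := hb1 ▸ hF.differentiableOn
  have hc : ∀ n, maclaurin F n = a n := by
    have h1 := (analyticAt_zero hd).hasFPowerSeriesAt
    have h2 := h1.eq_formalMultilinearSeries hF.hasFPowerSeriesAt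
    have h3 := FormalMultilinearSeries.ofScalars_series_injective ℂ ℂ h2
    exact fun n => congrFun h3 n
  refine ⟨⟨F, hd, fun z hz => if_neg hz, ?_⟩, ?_⟩
  · simp only [hc]
    exact sq_of_memlp a.2
  · ext n
    exact hc n

/-- The norm is `‖f‖² = ∑ |f̂(n)|²`. -/
noncomputable instance : NormedAddCommGroup H2 :=
  NormedAddCommGroup.induced H2 _ coeffs coeffs_injective

theorem norm_eq (f : H2) : ‖f‖ = ‖coeffs f‖ := rfl

/-- The inner product is `∑ f̂(n) ĝ(n)` with a conjugate on one factor. Mathlib's convention puts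
the conjugate on the first argument. -/
noncomputable instance : InnerProductSpace ℂ H2 where
  toNormedSpace := NormedSpace.induced ℂ H2 _ coeffs
  inner f g := inner ℂ (coeffs f) (coeffs g)
  norm_sq_eq_re_inner f := by rw [norm_eq, norm_sq_eq_re_inner (𝕜 := ℂ)]
  conj_inner_symm f g := inner_conj_symm _ _
  add_left f g h := by rw [map_add, inner_add_left]
  smul_left f g c := by rw [map_smul, inner_smul_left]

theorem inner_eq_tsum (f g : H2) :
    inner ℂ f g = ∑' n, maclaurin g n * (starRingEnd ℂ) (maclaurin f n) := by
  change inner ℂ (coeffs f) (coeffs g) = _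
  rw [lp.inner_eq_tsum]
  rfl

instance : CompleteSpace H2 := by
  let e : H2 ≃ₗᵢ[ℂ] lp (fun _ : ℕ => ℂ) 2 :=
    { LinearEquiv.ofBijective coeffs ⟨coeffs_injective, coeffs_surjective⟩ with
      norm_map' := fun _ => rfl }
  exact (completeSpace_congr (e := e.toEquiv) e.isometry.isUniformEmbedding).2 inferInstance

end H2

/-! ### Rational maps of the Riemann sphere -/

/-- The Riemann sphere. -/
abbrev Sphere : Type := OnePoint ℂ

/-- The finite point of the sphere given by a complex number. -/
abbrev pt (z : ℂ) : Sphere := (z : OnePoint ℂ)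

/-- The open unit disc, as a subset of the sphere. -/
def disc : Set Sphere := pt '' Metric.ball 0 1

/-- The complex number underlying a finite point of the sphere (with the default value `0` at
`∞`). -/
noncomputable def finitePart : Sphere → ℂ
  | OnePoint.infty => 0
  | OnePoint.some z => z

/-- The self-map of the sphere defined by a rational function, written as a quotient of relatively
prime polynomials. The value at `∞` is `∞` if the numerator has the larger degree, and otherwise
the quotient of the coefficients in degree `natDegree denom`. -/
noncomputable def toSphere (R : RatFunc ℂ) : Sphere → Sphere
  | OnePoint.infty =>
      if R.denom.natDegree < R.num.natDegree then OnePoint.infty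
      else pt (R.num.coeff R.denom.natDegree / R.denom.leadingCoeff)
  | OnePoint.some z =>
      if R.denom.eval z = 0 then OnePoint.infty else pt (R.num.eval z / R.denom.eval z)

/-- The degree of a rational function. -/
noncomputable def degree (R : RatFunc ℂ) : ℕ := max R.num.natDegree R.denom.natDegree

/-- The rational function maps the open unit disc into itself. -/
def IsDiscSelfMap (R : RatFunc ℂ) : Prop := Set.MapsTo (toSphere R) disc disc

/-- Inversion in the unit circle, `z ↦ 1 / conj z`, which exchanges `0` and `∞`. -/
noncomputable def inversion : Sphere → Sphere
  | OnePoint.infty => pt 0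
  | OnePoint.some z => if z = 0 then OnePoint.infty else pt (1 / (starRingEnd ℂ) z)

/-- The exterior map `φₑ = ρ ∘ φ ∘ ρ`. -/
noncomputable def exterior (R : RatFunc ℂ) : Sphere → Sphere :=
  inversion ∘ toSphere R ∘ inversion

/-- `w` is a regular value of the rational map `F` of the sphere: its preimage consists of exactly
as many distinct points as the degree of `F`. -/
def IsRegularValue (F : Sphere → Sphere) (w : Sphere) : Prop :=
  ∃ R : RatFunc ℂ, F = toSphere R ∧ (F ⁻¹' {w}).encard = degree R

/-- `σ` is a branch of `F⁻¹` defined on `Ω`: it is the inverse of the restriction of `F` to some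
open set that `F` maps injectively onto `Ω`. -/
def IsBranch (F : Sphere → Sphere) (Ω : Set Sphere) (σ : Sphere → Sphere) : Prop :=
  ∃ V₁ : Set Sphere, IsOpen V₁ ∧ Set.BijOn F V₁ Ω ∧ Set.InvOn σ F V₁ Ω

/-- A sphere-valued map `σ`, seen as a complex-valued function on the plane. -/
noncomputable def onPlane (σ : Sphere → Sphere) : ℂ → ℂ := fun z => finitePart (σ (pt z))

/-- `C` is the composition operator `f ↦ f ∘ φ` on `H²`. -/
def IsCompositionOperator (φ : RatFunc ℂ) (C : H2 →L[ℂ] H2) : Prop :=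
  ∀ (f : H2) (z : ℂ), z ∈ Metric.ball (0 : ℂ) 1 → C f z = f (onPlane (toSphere φ) z)

end RatComp

/-! Evaluation at `z` is pairing with the kernel k_z, so C*f(z) is the pairing of f with k_z ∘ φ,
and everything reduces to expanding k_z ∘ φ in kernels. Write φ = P/Q. Conjugating and reversing
coefficients in degree d gives φₑ = A/B, with A from Q (`extNum`) and B from P (`extDen`). With x =
1 / conj w and E = A - zB, the value k_z(φ(w)) is the conjugate of A(x)/E(x). The roots of E are the
preimages σ_j(z). There are d of them and deg E ≤ d, so they are simple, and
`eval_div_eq_partialFractions` expands A/E in a constant and the functions x/(x - s_j), whose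
conjugates are the kernels at s_j = σ_j(z). Hence (`adjoint_apply_eq_sum`) C*f(z) = A(0)/E(0) f(0) +
∑ A(s_j)/(s_j E'(s_j)) f(s_j). Since A(s_j) = z B(s_j) and σ_j' = B(s_j)/E'(s_j), the coefficients
are z σ_j'/σ_j. The constant A(0)/E(0) records φ(∞).

Boundedness of C is Littlewood subordination: |f|² has a harmonic majorant, built from the shift S
as the real part of ⟨f, (1 + vS)(1 - vS)⁻¹ f⟩ with v = conj w. Composed with φ it stays harmonic, so
the mean value property bounds the circle means of |f ∘ φ|². -/

namespace RatComp

open ComplexConjugate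

/-! ### Reproducing kernels, the shift and a harmonic majorant -/

namespace H2

@[simp] theorem add_apply (f g : H2) (z : ℂ) : (f + g) z = f z + g z := rfl

@[simp] theorem smul_apply (c : ℂ) (f : H2) (z : ℂ) : (c • f) z = c * f z := rfl

@[simp] theorem sub_apply (f g : H2) (z : ℂ) : (f - g) z = f z - g z := rfl

theorem sum_apply {ι : Type*} (s : Finset ι) (f : ι → H2) (z : ℂ) :
    (∑ i ∈ s, f i) z = ∑ i ∈ s, f i z := by
  classical
  induction s using Finset.induction_on with
  | empty => rfl
  | insert a s ha ih => rw [Finset.sum_insert ha, Finset.sum_insert ha, add_apply, ih]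

theorem ext_ball {f g : H2} (h : ∀ z ∈ Metric.ball (0 : ℂ) 1, f z = g z) : f = g := by
  refine Subtype.ext (funext fun z => ?_)
  by_cases hz : z ∈ Metric.ball (0 : ℂ) 1
  · exact h z hz
  · exact (f.isHardy.supp z hz).trans (g.isHardy.supp z hz).symm

theorem differentiableAt (f : H2) {z : ℂ} (hz : z ∈ Metric.ball (0 : ℂ) 1) :
    DifferentiableAt ℂ f z :=
  f.isHardy.holo.differentiableAt (Metric.isOpen_ball.mem_nhds hz)

/-- Two elements of `H²` that agree on the punctured disc are equal. -/
theorem ext_punctured {f g : H2} (h : ∀ z ∈ Metric.ball (0 : ℂ) 1, z ≠ 0 → f z = g z) :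
    f = g := by
  refine ext_ball fun z hz => ?_
  rcases eq_or_ne z 0 with rfl | h0
  · have hf := (f.differentiableAt hz).continuousAt
    have hg := (g.differentiableAt hz).continuousAt
    have hg' := hg.tendsto.mono_left (nhdsWithin_le_nhds (s := {0}ᶜ))
    refine tendsto_nhds_unique (hf.tendsto.mono_left nhdsWithin_le_nhds) (hg'.congr' ?_)
    filter_upwards [mem_nhdsWithin_of_mem_nhds (Metric.isOpen_ball.mem_nhds hz),
      self_mem_nhdsWithin] with w hw hw0
    exact (h w hw hw0).symm
  · exact h z hz h0

/-- The element of `H²` with given square-summable coefficients. -/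
theorem exists_of_sq_summable {a : ℕ → ℂ} (h : Summable fun n => ‖a n‖ ^ 2) :
    ∃ f : H2, ∀ n, maclaurin f n = a n := by
  obtain ⟨f, hf⟩ := coeffs_surjective ⟨a, memlp_of_sq h⟩
  exact ⟨f, fun n => by rw [← coeffs_apply, hf]⟩

theorem norm_sq_eq_tsum (f : H2) : ‖f‖ ^ 2 = ∑' n, ‖maclaurin f n‖ ^ 2 := by
  have h := lp.norm_rpow_eq_tsum (p := 2) (by norm_num) (coeffs f)
  simpa [norm_eq, coeffs_apply] using h

theorem summable_kernel {w : ℂ} (hw : w ∈ Metric.ball (0 : ℂ) 1) :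
    Summable fun n : ℕ => ‖conj w ^ n‖ ^ 2 := by
  have hw' : ‖w‖ < 1 := by simpa using hw
  have : ‖w‖ ^ 2 < 1 := by nlinarith [norm_nonneg w]
  refine (summable_geometric_of_lt_one (sq_nonneg _) this).congr fun n => ?_
  rw [norm_pow, RCLike.norm_conj, ← pow_mul, ← pow_mul, mul_comm]

open Classical in
/-- The reproducing kernel `z ↦ 1 / (1 - conj w * z)` at the point `w` of the disc. -/
noncomputable def kernel (w : ℂ) : H2 :=
  if hw : w ∈ Metric.ball (0 : ℂ) 1 then (exists_of_sq_summable (summable_kernel hw)).choose else 0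

theorem maclaurin_kernel {w : ℂ} (hw : w ∈ Metric.ball (0 : ℂ) 1) (n : ℕ) :
    maclaurin (kernel w) n = conj w ^ n := by
  rw [kernel, dif_pos hw]
  exact (exists_of_sq_summable (summable_kernel hw)).choose_spec n

theorem kernel_apply {w z : ℂ} (hw : w ∈ Metric.ball (0 : ℂ) 1) (hz : z ∈ Metric.ball (0 : ℂ) 1) :
    kernel w z = 1 / (1 - conj w * z) := by
  have h := (kernel w).hasSum hz
  simp only [maclaurin_kernel hw, ← mul_pow] at h
  have hn : ‖conj w * z‖ < 1 := by
    rw [norm_mul, RCLike.norm_conj]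
    simp only [Metric.mem_ball, dist_zero_right] at hw hz
    nlinarith [norm_nonneg w, norm_nonneg z]
  rw [h.unique (hasSum_geometric_of_norm_lt_one hn), one_div]

theorem inner_kernel (f : H2) {w : ℂ} (hw : w ∈ Metric.ball (0 : ℂ) 1) :
    inner ℂ (kernel w) f = f w := by
  rw [inner_eq_tsum, ← (f.hasSum hw).tsum_eq]
  refine tsum_congr fun n => ?_
  rw [maclaurin_kernel hw, map_pow, Complex.conj_conj]

theorem norm_kernel_sq {w : ℂ} (hw : w ∈ Metric.ball (0 : ℂ) 1) :
    ‖kernel w‖ ^ 2 = 1 / (1 - ‖w‖ ^ 2) := by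
  have h := inner_kernel (kernel w) hw
  rw [kernel_apply hw hw, Complex.conj_mul'] at h
  have h2 := inner_self_eq_norm_sq (𝕜 := ℂ) (kernel w)
  rw [h, RCLike.re_eq_complex_re] at h2
  rw [← h2]
  norm_cast

/-- Cauchy–Schwarz against the reproducing kernel at `w`. -/
theorem norm_apply_sq_le (f : H2) {w : ℂ} (hw : w ∈ Metric.ball (0 : ℂ) 1) :
    (1 - ‖w‖ ^ 2) * ‖f w‖ ^ 2 ≤ ‖f‖ ^ 2 := by
  have hw' : ‖w‖ < 1 := by simpa using hw
  have hpos : 0 < 1 - ‖w‖ ^ 2 := by nlinarith [norm_nonneg w]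
  have h := norm_inner_le_norm (𝕜 := ℂ) (kernel w) f
  rw [inner_kernel f hw] at h
  have h2 : ‖f w‖ ^ 2 ≤ ‖kernel w‖ ^ 2 * ‖f‖ ^ 2 := by
    rw [← mul_pow]; exact pow_le_pow_left₀ (norm_nonneg _) h 2
  rw [norm_kernel_sq hw, one_div_mul_eq_div, le_div_iff₀ hpos] at h2
  linarith

theorem summable_shift (f : H2) :
    Summable fun n : ℕ => ‖(n.casesOn 0 (maclaurin f) : ℂ)‖ ^ 2 :=
  (summable_nat_add_iff 1).1 f.isHardy.sq_summable

theorem exists_shift (f : H2) : ∃ g : H2, (∀ z ∈ Metric.ball (0 : ℂ) 1, g z = z * f z) ∧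
    ‖g‖ = ‖f‖ := by
  obtain ⟨g, hg⟩ := exists_of_sq_summable f.summable_shift
  refine ⟨g, fun z hz => ?_, ?_⟩
  · rw [← (g.hasSum hz).tsum_eq, ← (f.hasSum hz).tsum_eq, (g.hasSum hz).summable.tsum_eq_zero_add,
      ← tsum_mul_left]
    have h0 : maclaurin g 0 = 0 := hg 0
    rw [h0, zero_mul, zero_add]
    refine tsum_congr fun n => ?_
    rw [show maclaurin g (n + 1) = maclaurin f n from hg (n + 1), pow_succ]
    ring
  · refine (sq_eq_sq₀ (norm_nonneg _) (norm_nonneg _)).1 ?_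
    rw [norm_sq_eq_tsum, norm_sq_eq_tsum, g.isHardy.sq_summable.tsum_eq_zero_add]
    simp [hg]

/-- Multiplication by the coordinate function, as an isometry of `H²`. -/
noncomputable def shift : H2 →ₗᵢ[ℂ] H2 where
  toFun f := (exists_shift f).choose
  map_add' f g := ext_ball fun z hz => by
    rw [add_apply, (exists_shift _).choose_spec.1 z hz, (exists_shift f).choose_spec.1 z hz,
      (exists_shift g).choose_spec.1 z hz, add_apply, mul_add]
  map_smul' c f := ext_ball fun z hz => by
    rw [RingHom.id_apply, smul_apply, (exists_shift _).choose_spec.1 z hz,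
      (exists_shift f).choose_spec.1 z hz, smul_apply]
    ring
  norm_map' f := (exists_shift f).choose_spec.2

theorem shift_apply (f : H2) {z : ℂ} (hz : z ∈ Metric.ball (0 : ℂ) 1) : shift f z = z * f z :=
  (exists_shift f).choose_spec.1 z hz

/-- The operator `(1 + v S) (1 - v S)⁻¹`, where `S` is the shift. -/
noncomputable def herglotzOp (v : ℂ) : H2 →L[ℂ] H2 :=
  (1 + v • shift.toContinuousLinearMap) * Ring.inverse (1 - v • shift.toContinuousLinearMap)

theorem isUnit_one_sub_smul_shift {v : ℂ} (hv : v ∈ Metric.ball (0 : ℂ) 1) :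
    IsUnit (1 - v • shift.toContinuousLinearMap : H2 →L[ℂ] H2) := by
  refine isUnit_one_sub_of_norm_lt_one ?_
  have hv' : ‖v‖ < 1 := by simpa using hv
  rw [norm_smul]
  have := shift.norm_toContinuousLinearMap_le
  nlinarith [norm_nonneg v]

/-- Inversion in a Banach algebra is differentiable at every unit. This makes the Herglotz operator
holomorphic in its parameter. -/
theorem _root_.differentiableAt_cayley {A : Type*} [NormedRing A] [NormedAlgebra ℂ A]
    [CompleteSpace A] {S : A} {v : ℂ} (h : IsUnit (1 - v • S)) :
    DifferentiableAt ℂ (fun v : ℂ => (1 + v • S) * Ring.inverse (1 - v • S)) v := by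
  have hS : DifferentiableAt ℂ (fun v : ℂ => v • S) v := differentiableAt_id.smul_const S
  have hi : DifferentiableAt ℂ (fun v : ℂ => Ring.inverse (1 - v • S)) v :=
    DifferentiableAt.comp v (f := fun v : ℂ => 1 - v • S) (differentiableAt_inverse h)
      (hS.const_sub 1)
  exact (hS.const_add 1).mul hi

theorem differentiableAt_herglotzOp {v : ℂ} (hv : v ∈ Metric.ball (0 : ℂ) 1) :
    DifferentiableAt ℂ herglotzOp v :=
  differentiableAt_cayley (isUnit_one_sub_smul_shift hv)

/-- A harmonic majorant of `|f|²`. -/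
theorem norm_apply_sq_le_re_herglotzOp (f : H2) {w : ℂ} (hw : w ∈ Metric.ball (0 : ℂ) 1) :
    ‖f w‖ ^ 2 ≤ (inner ℂ f (herglotzOp (conj w) f)).re := by
  have hw' : ‖w‖ < 1 := by simpa using hw
  have hv : conj w ∈ Metric.ball (0 : ℂ) 1 := by simpa using hw
  set T : H2 →L[ℂ] H2 := 1 - conj w • shift.toContinuousLinearMap with hT
  -- With h = conj w • S g one has f = g - h, while the Herglotz operator sends f to g + h.
  set g : H2 := Ring.inverse T f with hg
  have hfg : f = g - conj w • shift g := by
    have : (T * Ring.inverse T) f = f := by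
      rw [Ring.mul_inverse_cancel _ (isUnit_one_sub_smul_shift hv)]; rfl
    rw [← this]
    rfl
  have hk : herglotzOp (conj w) f = g + conj w • shift g := rfl
  -- Re ⟨g - h, g + h⟩ = ‖g‖² - ‖h‖², and ‖h‖ = |w| ‖g‖ because the shift is isometric.
  have hre : (inner ℂ f (herglotzOp (conj w) f)).re = (1 - ‖w‖ ^ 2) * ‖g‖ ^ 2 := by
    rw [hk]
    conv_lhs => rw [hfg]
    have hn : ‖conj w • shift g‖ ^ 2 = ‖w‖ ^ 2 * ‖g‖ ^ 2 := by
      rw [norm_smul, RCLike.norm_conj, shift.norm_map, mul_pow]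
    set h := conj w • shift g
    rw [inner_sub_left, inner_add_right, inner_add_right]
    have hgg : (inner ℂ g g : ℂ).re = ‖g‖ ^ 2 := inner_self_eq_norm_sq (𝕜 := ℂ) g
    have hhh : (inner ℂ h h : ℂ).re = ‖h‖ ^ 2 := inner_self_eq_norm_sq (𝕜 := ℂ) h
    have hs : (inner ℂ g h : ℂ).re = (inner ℂ h g : ℂ).re := inner_re_symm (𝕜 := ℂ) g h
    simp only [Complex.sub_re, Complex.add_re, hs, hgg, hhh, hn]
    ring
  have hval : f w = (1 - ‖w‖ ^ 2 : ℝ) * g w := by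
    conv_lhs => rw [hfg]
    rw [sub_apply, smul_apply, shift_apply g hw, ← mul_assoc, Complex.conj_mul']
    push_cast
    ring
  have hpos : 0 < 1 - ‖w‖ ^ 2 := by nlinarith [norm_nonneg w]
  rw [hre, hval, norm_mul, Complex.norm_real, Real.norm_of_nonneg hpos.le, mul_pow, sq (1 - ‖w‖ ^ 2),
    mul_assoc]
  exact mul_le_mul_of_nonneg_left (g.norm_apply_sq_le hw) hpos.le

end H2

end RatComp

/-! ### Littlewood subordination and boundedness of composition operators -/

namespace RatComp

open ComplexConjugate

theorem maclaurin_pow (m n : ℕ) :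
    maclaurin (fun z => z ^ m) n = if m = n then 1 else 0 := by
  unfold maclaurin
  rw [iteratedDeriv_fun_pow_zero]
  split_ifs with h h' h'
  · rw [h, div_self (by exact_mod_cast m.factorial_ne_zero)]
  · exact absurd h.symm h'
  · exact absurd h'.symm h
  · simp

theorem closedBall_subset_unitBall {r : ℝ} (h1 : r < 1) :
    Metric.closedBall (0 : ℂ) r ⊆ Metric.ball 0 1 :=
  Metric.closedBall_subset_ball h1

theorem circleIntegrable_of_continuousOn_ball {E : Type*} [NormedAddCommGroup E] {G : ℂ → E}
    (hG : ContinuousOn G (Metric.ball 0 1)) {r : ℝ} (h0 : 0 < r) (h1 : r < 1) :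
    CircleIntegrable G 0 r :=
  (hG.mono (by
    rw [abs_of_pos h0]
    exact Metric.sphere_subset_closedBall.trans (closedBall_subset_unitBall h1))).circleIntegrable'

/-- On the circle conj z = r²/z, which turns the average into Cauchy's integral for the n-th
coefficient. -/
theorem circleAverage_mul_conj_pow {F : ℂ → ℂ} (hF : DifferentiableOn ℂ F (Metric.ball 0 1))
    {r : ℝ} (h0 : 0 < r) (h1 : r < 1) (n : ℕ) :
    Real.circleAverage (fun z => F z * conj z ^ n) 0 r = maclaurin F n * r ^ (2 * n) := by
  have hc := (hF.mono (closedBall_subset_unitBall h1)).circleIntegral_one_div_sub_center_pow_smul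
    h0 n
  rw [Real.circleAverage_eq_circleIntegral h0.ne']
  have he : (∮ z in C(0, r), (z - 0)⁻¹ • (F z * conj z ^ n)) =
      ∮ z in C(0, r), ((r : ℂ) ^ (2 * n)) • ((1 / (z - 0) ^ (n + 1)) • F z) := by
    refine circleIntegral.integral_congr h0.le fun z hz => ?_
    have hz' : ‖z‖ = r := by simpa using hz
    have hz0 : z ≠ 0 := by
      rintro rfl
      simp at hz'
      exact h0.ne hz'
    have hzz : conj z = r ^ 2 / z := by
      rw [eq_div_iff hz0, Complex.conj_mul', hz']
    simp only [hzz, smul_eq_mul, sub_zero, div_pow]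
    field_simp
    ring
  rw [he, circleIntegral.integral_smul, hc, maclaurin]
  have := Complex.two_pi_I_ne_zero
  have hn : (n.factorial : ℂ) ≠ 0 := by exact_mod_cast n.factorial_ne_zero
  simp only [smul_eq_mul]
  field_simp

/-- Bessel's inequality: average |F - P|² ≥ 0 with P the Taylor polynomial. Both Re (F conj P) and
|P|² average to the left-hand side. -/
theorem sum_norm_maclaurin_sq_le {F : ℂ → ℂ} (hF : DifferentiableOn ℂ F (Metric.ball 0 1))
    {r : ℝ} (h0 : 0 < r) (h1 : r < 1) (N : ℕ) :
    ∑ n ∈ Finset.range N, ‖maclaurin F n‖ ^ 2 * r ^ (2 * n) ≤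
      Real.circleAverage (fun z => ‖F z‖ ^ 2) 0 r := by
  set P : ℂ → ℂ := fun z => ∑ n ∈ Finset.range N, maclaurin F n * z ^ n with hP
  have hFc := hF.continuousOn
  have hPc : Continuous P := by fun_prop
  have hPconj : ∀ z, conj (P z) = ∑ n ∈ Finset.range N, conj (maclaurin F n) * conj z ^ n := by
    intro z
    simp [hP]
  have key : ∀ G : ℂ → ℂ, DifferentiableOn ℂ G (Metric.ball 0 1) →
      Real.circleAverage (fun z => G z * conj (P z)) 0 r =
        ∑ n ∈ Finset.range N, conj (maclaurin F n) * (maclaurin G n * r ^ (2 * n)) := by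
    intro G hG
    have hGc := hG.continuousOn
    have : (fun z => G z * conj (P z)) =
        fun z => ∑ n ∈ Finset.range N, (conj (maclaurin F n)) • (G z * conj z ^ n) := by
      funext z
      rw [hPconj, Finset.mul_sum]
      exact Finset.sum_congr rfl fun n _ => by rw [smul_eq_mul]; ring
    rw [this, Real.circleAverage_fun_sum]
    · refine Finset.sum_congr rfl fun n _ => ?_
      rw [Real.circleAverage_fun_smul, circleAverage_mul_conj_pow hG h0 h1, smul_eq_mul]
    · intro n _
      exact circleIntegrable_of_continuousOn_ball (by fun_prop) h0 h1
  have hPd : DifferentiableOn ℂ P (Metric.ball 0 1) := by fun_prop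
  have hPm : ∀ n ∈ Finset.range N, maclaurin P n = maclaurin F n := by
    intro n hn
    have hcoef : ∀ s : Finset ℕ, maclaurin (fun z => ∑ m ∈ s, maclaurin F m * z ^ m) n =
        ∑ m ∈ s, maclaurin F m * maclaurin (fun z => z ^ m) n := by
      intro s
      induction s using Finset.induction_on with
      | empty => exact (maclaurin_zero n).trans Finset.sum_empty.symm
      | insert a s ha ih =>
        simp only [Finset.sum_insert ha]
        rw [← ih, ← maclaurin_smul]
        exact maclaurin_add (by fun_prop) (by fun_prop) n
    rw [hP, hcoef]
    simp only [maclaurin_pow, mul_ite, mul_one, mul_zero]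
    rw [Finset.sum_ite_eq' (Finset.range N) n, if_pos hn]
  have hsum : ∀ G : ℂ → ℂ, DifferentiableOn ℂ G (Metric.ball 0 1) →
      (∀ n ∈ Finset.range N, maclaurin G n = maclaurin F n) →
      Real.circleAverage (fun z => (G z * conj (P z)).re) 0 r =
        ∑ n ∈ Finset.range N, ‖maclaurin F n‖ ^ 2 * r ^ (2 * n) := by
    intro G hG hm
    have hGc := hG.continuousOn
    have h := Complex.reCLM.circleAverage_comp_comm (f := fun z => G z * conj (P z)) (c := 0)
      (R := r) (circleIntegrable_of_continuousOn_ball (by fun_prop) h0 h1)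
    rw [key G hG] at h
    refine h.trans ?_
    rw [Complex.reCLM_apply, Complex.re_sum]
    refine Finset.sum_congr rfl fun n hn => ?_
    rw [hm n hn, ← mul_assoc, Complex.conj_mul']
    norm_cast
  have hi1 : CircleIntegrable (fun z => (F z * conj (P z)).re) 0 r :=
    circleIntegrable_of_continuousOn_ball (by fun_prop) h0 h1
  have hi2 : CircleIntegrable (fun z => (P z * conj (P z)).re) 0 r :=
    circleIntegrable_of_continuousOn_ball (by fun_prop) h0 h1
  have hi3 : CircleIntegrable (fun z => ‖F z‖ ^ 2) 0 r :=
    circleIntegrable_of_continuousOn_ball (by fun_prop) h0 h1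
  have hle := Real.circleAverage_mono ((hi1.add hi1).sub hi2) hi3 (fun z _ => by
    have h1 : ‖F z - P z‖ ^ 2 = ‖F z‖ ^ 2 - 2 * (F z * conj (P z)).re + (P z * conj (P z)).re := by
      rw [Complex.mul_conj, Complex.ofReal_re, Complex.sq_norm, Complex.sq_norm,
        Complex.normSq_sub]
      ring
    have h2 := sq_nonneg ‖F z - P z‖
    simp only [Pi.sub_apply, Pi.add_apply]
    linarith)
  rw [Real.circleAverage_sub (hi1.add hi1) hi2, Real.circleAverage_add hi1 hi1,
    hsum F hF fun _ _ => rfl, hsum P hPd hPm] at hle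
  linarith

/-- **Littlewood's subordination principle** for the Hardy space `H²`. -/
theorem exists_comp_mem_H2 {u : ℂ → ℂ} (hu : DifferentiableOn ℂ u (Metric.ball 0 1))
    (hmaps : Set.MapsTo u (Metric.ball 0 1) (Metric.ball 0 1)) (f : H2) :
    ∃ g : H2, (∀ z ∈ Metric.ball (0 : ℂ) 1, g z = f (u z)) ∧
      ‖g‖ ^ 2 ≤ ‖H2.herglotzOp (conj (u 0))‖ * ‖f‖ ^ 2 := by
  classical
  set B := Metric.ball (0 : ℂ) 1 with hB
  set F : ℂ → ℂ := fun z => if z ∈ B then f (u z) else 0 with hF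
  have hFd : DifferentiableOn ℂ F B := by
    refine (f.isHardy.holo.comp hu hmaps).congr fun z hz => ?_
    simp [hF, hz]
  set k : ℂ → ℂ := fun v => inner ℂ f (H2.herglotzOp v f) with hk
  have hkd : DifferentiableOn ℂ k B := by
    intro v hv
    have h1 := H2.differentiableAt_herglotzOp hv
    have h2 : DifferentiableAt ℂ (fun v => innerSL ℂ f (H2.herglotzOp v f)) v :=
      (innerSL ℂ f).differentiableAt.comp v (h1.clm_apply (differentiableAt_const f))
    exact h2.differentiableWithinAt
  -- The Herglotz operator is holomorphic in conj w, so the two conjugations make h holomorphic in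
  -- z. The outer one does not change the real part.
  set h : ℂ → ℂ := fun z => conj (k (conj (u z))) with hh
  have hhd : DifferentiableOn ℂ h B := by
    have hstar : DifferentiableOn ℂ (fun w => conj (k (conj w))) B := by
      intro w hw
      have hw' : conj w ∈ B := by simpa [hB] using hw
      have := (hkd.differentiableAt (Metric.isOpen_ball.mem_nhds hw')).conj_conj
      rw [Complex.conj_conj] at this
      exact this.differentiableWithinAt
    exact hstar.comp hu hmaps
  have hmean : ∀ r : ℝ, 0 < r → r < 1 →
      Real.circleAverage (fun z => (h z).re) 0 r = (h 0).re := by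
    intro r h0 h1
    have hm : Real.circleAverage h 0 r = h 0 := by
      refine DiffContOnCl.circleAverage ?_
      rw [abs_of_pos h0]
      exact (hhd.mono ((Metric.closure_ball_subset_closedBall).trans
        (closedBall_subset_unitBall h1))).diffContOnCl
    have := Complex.reCLM.circleAverage_comp_comm (f := h) (c := 0)
      (R := r) (circleIntegrable_of_continuousOn_ball hhd.continuousOn h0 h1)
    rw [hm] at this
    exact this
  set M : ℝ := ‖H2.herglotzOp (conj (u 0))‖ * ‖f‖ ^ 2 with hM
  have hbound : (h 0).re ≤ M := by
    refine (Complex.re_le_norm _).trans ?_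
    rw [hh, RCLike.norm_conj]
    refine (norm_inner_le_norm _ _).trans ?_
    calc ‖f‖ * ‖H2.herglotzOp (conj (u 0)) f‖
        ≤ ‖f‖ * (‖H2.herglotzOp (conj (u 0))‖ * ‖f‖) :=
          mul_le_mul_of_nonneg_left (ContinuousLinearMap.le_opNorm _ _) (norm_nonneg _)
      _ = M := by rw [hM]; ring
  have hr : ∀ r : ℝ, 0 < r → r < 1 → ∀ N,
      ∑ n ∈ Finset.range N, ‖maclaurin F n‖ ^ 2 * r ^ (2 * n) ≤ M := by
    intro r h0 h1 N
    have hFc := hFd.continuousOn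
    have hhc := hhd.continuousOn
    refine (sum_norm_maclaurin_sq_le hFd h0 h1 N).trans (le_trans ?_ hbound)
    rw [← hmean r h0 h1]
    refine Real.circleAverage_mono (circleIntegrable_of_continuousOn_ball (by fun_prop) h0 h1)
      (circleIntegrable_of_continuousOn_ball (by fun_prop) h0 h1) fun z hz => ?_
    have hz' : z ∈ B := by
      rw [abs_of_pos h0] at hz
      exact closedBall_subset_unitBall h1 (Metric.sphere_subset_closedBall hz)
    simp only [hF, if_pos hz', hh, Complex.conj_re]
    exact H2.norm_apply_sq_le_re_herglotzOp f (hmaps hz')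
  -- The bound `M` does not depend on r, so r → 1 is allowed in each finite sum.
  have hN : ∀ N, ∑ n ∈ Finset.range N, ‖maclaurin F n‖ ^ 2 ≤ M := by
    intro N
    have hc : Continuous fun r : ℝ => ∑ n ∈ Finset.range N, ‖maclaurin F n‖ ^ 2 * r ^ (2 * n) := by
      fun_prop
    have ht := (hc.tendsto 1).mono_left (nhdsWithin_le_nhds (s := Set.Iio 1))
    simp only [one_pow, mul_one] at ht
    refine le_of_tendsto ht ?_
    filter_upwards [Ioo_mem_nhdsLT (show (0 : ℝ) < 1 from one_pos)] with r hrr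
    exact hr r hrr.1 hrr.2 N
  have hs : Summable fun n => ‖maclaurin F n‖ ^ 2 :=
    summable_of_sum_range_le (fun _ => sq_nonneg _) hN
  have hg : IsHardy F := ⟨hFd, fun z hz => if_neg hz, hs⟩
  refine ⟨(⟨F, hg⟩ : hardySubmodule), fun z hz => if_pos hz, ?_⟩
  refine (H2.norm_sq_eq_tsum _).trans_le ?_
  exact Real.tsum_le_of_sum_range_le (fun _ => sq_nonneg _) hN

/-- The composition operator with holomorphic symbol `u` on `H²`. -/
theorem exists_compositionOperator {u : ℂ → ℂ} (hu : DifferentiableOn ℂ u (Metric.ball 0 1))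
    (hmaps : Set.MapsTo u (Metric.ball 0 1) (Metric.ball 0 1)) :
    ∃ C : H2 →L[ℂ] H2, ∀ (f : H2), ∀ z ∈ Metric.ball (0 : ℂ) 1, C f z = f (u z) := by
  choose g hg hb using exists_comp_mem_H2 hu hmaps
  let L : H2 →ₗ[ℂ] H2 :=
    { toFun := g
      map_add' := fun a b => H2.ext_ball fun z hz => by
        rw [H2.add_apply, hg _ z hz, hg _ z hz, hg _ z hz, H2.add_apply]
      map_smul' := fun c a => H2.ext_ball fun z hz => by
        rw [RingHom.id_apply, H2.smul_apply, hg _ z hz, hg _ z hz, H2.smul_apply] }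
  refine ⟨L.mkContinuous (Real.sqrt ‖H2.herglotzOp (conj (u 0))‖) fun f => ?_, hg⟩
  refine (Real.le_sqrt_of_sq_le (hb f)).trans_eq ?_
  rw [Real.sqrt_mul (norm_nonneg _), Real.sqrt_sq (norm_nonneg _)]

end RatComp

namespace RatComp

open ComplexConjugate Polynomial

/-! ### The exterior map as a quotient of polynomials -/

/-- Reversal of coefficients is s ^ N f(1/s). Conjugating the coefficients as well matches the two
inversions in φₑ. -/
theorem eval_reflect_map_conj {f : ℂ[X]} {N : ℕ} (hf : f.natDegree ≤ N) {s : ℂ} (hs : s ≠ 0) :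
    (reflect N (f.map (starRingEnd ℂ))).eval s = s ^ N * conj (f.eval (conj s)⁻¹) := by
  have hs' : s⁻¹ ≠ 0 := inv_ne_zero hs
  let _ : Invertible s⁻¹ := invertibleOfNonzero hs'
  have h := eval₂_reflect_mul_pow (RingHom.id ℂ) s⁻¹ N (f.map (starRingEnd ℂ))
    (natDegree_map_le.trans hf)
  rw [invOf_eq_inv, inv_inv] at h
  change eval s _ * _ = eval s⁻¹ _ at h
  have h2 : eval s⁻¹ (f.map (starRingEnd ℂ)) = conj (f.eval (conj s)⁻¹) := by
    have hc : s⁻¹ = conj (conj s)⁻¹ := by simp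
    rw [eval_map, hc, eval₂_hom]
  rw [← h2, ← h, inv_pow]
  field_simp

/-- For N the degree of φ, these values at 0 carry the value of φ at ∞. -/
theorem eval_zero_reflect_map_conj (f : ℂ[X]) (N : ℕ) :
    (reflect N (f.map (starRingEnd ℂ))).eval 0 = conj (f.coeff N) := by
  rw [← coeff_zero_eq_eval_zero, coeff_reflect, revAt_le (Nat.zero_le N), Nat.sub_zero, coeff_map]

/-- The numerator of the exterior map. -/
noncomputable def extNum (φ : RatFunc ℂ) : ℂ[X] :=
  reflect (degree φ) (φ.denom.map (starRingEnd ℂ))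

/-- The denominator of the exterior map. -/
noncomputable def extDen (φ : RatFunc ℂ) : ℂ[X] :=
  reflect (degree φ) (φ.num.map (starRingEnd ℂ))

theorem natDegree_reflect_map_le {f : ℂ[X]} {N : ℕ} (hf : f.natDegree ≤ N) :
    (reflect N (f.map (starRingEnd ℂ))).natDegree ≤ N :=
  natDegree_le_iff_coeff_eq_zero.2 fun k hk => by
    rw [coeff_reflect, revAt_eq_self_of_lt hk, coeff_map,
      coeff_eq_zero_of_natDegree_lt (hf.trans_lt hk), map_zero]

theorem natDegree_extNum_le (φ : RatFunc ℂ) : (extNum φ).natDegree ≤ degree φ :=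
  natDegree_reflect_map_le (le_max_right _ _)

theorem natDegree_extDen_le (φ : RatFunc ℂ) : (extDen φ).natDegree ≤ degree φ :=
  natDegree_reflect_map_le (le_max_left _ _)

theorem eval_extNum {φ : RatFunc ℂ} {s : ℂ} (hs : s ≠ 0) :
    (extNum φ).eval s = s ^ degree φ * conj (φ.denom.eval (conj s)⁻¹) :=
  eval_reflect_map_conj (le_max_right _ _) hs

theorem eval_extDen {φ : RatFunc ℂ} {s : ℂ} (hs : s ≠ 0) :
    (extDen φ).eval s = s ^ degree φ * conj (φ.num.eval (conj s)⁻¹) :=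
  eval_reflect_map_conj (le_max_left _ _) hs

theorem num_eval_ne_zero {φ : RatFunc ℂ} {y : ℂ} (h : φ.denom.eval y = 0) : φ.num.eval y ≠ 0 := by
  obtain ⟨a, b, hab⟩ := φ.isCoprime_num_denom
  intro h'
  have := congrArg (eval y) hab
  simp [h, h'] at this

theorem toSphere_pt (φ : RatFunc ℂ) (y : ℂ) :
    toSphere φ (pt y) = if φ.denom.eval y = 0 then OnePoint.infty
      else pt (φ.num.eval y / φ.denom.eval y) := rfl

theorem toSphere_infty (φ : RatFunc ℂ) :
    toSphere φ OnePoint.infty = if φ.denom.natDegree < φ.num.natDegree then OnePoint.infty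
      else pt (φ.num.coeff φ.denom.natDegree / φ.denom.leadingCoeff) := rfl

theorem inversion_pt (z : ℂ) :
    inversion (pt z) = if z = 0 then OnePoint.infty else pt (1 / conj z) := rfl

theorem inversion_infty : inversion OnePoint.infty = pt 0 := rfl

theorem inversion_inversion (x : Sphere) : inversion (inversion x) = x := by
  induction x using OnePoint.rec with
  | infty => rw [inversion_infty, inversion_pt, if_pos rfl]
  | coe z =>
    change inversion (inversion (pt z)) = pt z
    rw [inversion_pt]
    split_ifs with h
    · rw [inversion_infty, h]
    · rw [inversion_pt, if_neg (by simpa using h)]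
      simp

/-- The value of `φ` at infinity in terms of the coefficients in the degree of `φ`. -/
theorem toSphere_infty_eq_pt {φ : RatFunc ℂ} {c : ℂ} (h : toSphere φ OnePoint.infty = pt c) :
    φ.denom.coeff (degree φ) = 1 ∧ φ.num.coeff (degree φ) = c := by
  rw [toSphere_infty] at h
  split_ifs at h with h1
  · exact absurd h (OnePoint.infty_ne_coe c)
  · have hd : degree φ = φ.denom.natDegree := max_eq_right (not_lt.1 h1)
    have hm : φ.denom.leadingCoeff = 1 := φ.monic_denom
    have := OnePoint.coe_injective h
    rw [hm, div_one] at this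
    rw [hd]
    exact ⟨hm, this⟩

theorem toSphere_infty_eq_infty {φ : RatFunc ℂ} (h : toSphere φ OnePoint.infty = OnePoint.infty) :
    φ.denom.coeff (degree φ) = 0 ∧ φ.num.coeff (degree φ) ≠ 0 := by
  rw [toSphere_infty] at h
  split_ifs at h with h1
  · have hd : degree φ = φ.num.natDegree := max_eq_left h1.le
    rw [hd]
    refine ⟨coeff_eq_zero_of_natDegree_lt h1, ?_⟩
    rw [coeff_natDegree, leadingCoeff_ne_zero]
    rintro h0
    simp [h0] at h1
  · exact absurd h (OnePoint.coe_ne_infty _)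

theorem inversion_pt_div (a b : ℂ) (hb : b ≠ 0) :
    inversion (pt (a / b)) = if conj a = 0 then OnePoint.infty else pt (conj b / conj a) := by
  rw [inversion_pt]
  by_cases ha : a = 0
  · simp [ha]
  · rw [if_neg (div_ne_zero ha hb), if_neg (by simpa using ha)]
    simp

/-- Coprimality of P and Q excludes common zeros of A and B, so a zero of B is a pole. The point s =
0 is separate: there the value comes from φ(∞), that is, from the coefficients of P and Q in degree
d. -/
theorem exterior_pt (φ : RatFunc ℂ) (s : ℂ) :
    exterior φ (pt s) = if (extDen φ).eval s = 0 then OnePoint.infty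
      else pt ((extNum φ).eval s / (extDen φ).eval s) := by
  change inversion (toSphere φ (inversion (pt s))) = _
  by_cases hs : s = 0
  · subst hs
    rw [inversion_pt, if_pos rfl, extDen, extNum, eval_zero_reflect_map_conj,
      eval_zero_reflect_map_conj]
    cases h : toSphere φ OnePoint.infty using OnePoint.rec with
    | infty =>
      obtain ⟨h1, h2⟩ := toSphere_infty_eq_infty h
      rw [inversion_infty, h1, if_neg (by simpa using h2)]
      simp
    | coe c =>
      obtain ⟨h1, h2⟩ := toSphere_infty_eq_pt h
      have := inversion_pt_div c 1 one_ne_zero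
      rw [div_one] at this
      rw [h1, h2]
      exact this
  · rw [inversion_pt, if_neg hs, toSphere_pt, one_div, eval_extNum hs, eval_extDen hs]
    have hp : s ^ degree φ ≠ 0 := pow_ne_zero _ hs
    split_ifs with h1 h2 h2
    · have := num_eval_ne_zero h1
      simp [hs, this] at h2
    · rw [h1, inversion_infty]
      simp
    · rw [inversion_pt_div _ _ h1, if_pos (by simpa [hs] using h2)]
    · rw [inversion_pt_div _ _ h1, if_neg (by simpa [hs] using h2), mul_div_mul_left _ _ hp]

theorem exterior_pt_eq_pt {φ : RatFunc ℂ} {s z : ℂ} (h : exterior φ (pt s) = pt z) :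
    (extDen φ).eval s ≠ 0 ∧ (extNum φ).eval s / (extDen φ).eval s = z := by
  rw [exterior_pt] at h
  split_ifs at h with h1
  · exact absurd h (OnePoint.infty_ne_coe z)
  · exact ⟨h1, OnePoint.coe_injective h⟩

/-! ### Rational self-maps of the disc -/

theorem IsDiscSelfMap.denom_ne_zero {φ : RatFunc ℂ} (hφ : IsDiscSelfMap φ)
    {y : ℂ} (hy : y ∈ Metric.ball (0 : ℂ) 1) :
    φ.denom.eval y ≠ 0 ∧ ‖φ.num.eval y‖ < ‖φ.denom.eval y‖ := by
  obtain ⟨w, hw, hw'⟩ := hφ (Set.mem_image_of_mem pt hy)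
  rw [toSphere_pt] at hw'
  split_ifs at hw' with h
  · exact absurd hw' (OnePoint.coe_ne_infty w)
  · refine ⟨h, ?_⟩
    have h2 := OnePoint.coe_injective hw'
    rw [Metric.mem_ball, dist_zero_right, h2, norm_div, div_lt_one (norm_pos_iff.2 h)] at hw
    exact hw

/-- The inequality passes to the closure by continuity. A pole on the circle would then force P to
vanish there too, against coprimality. -/
theorem IsDiscSelfMap.norm_num_le {φ : RatFunc ℂ} (hφ : IsDiscSelfMap φ) {y : ℂ} (hy : ‖y‖ ≤ 1) :
    φ.denom.eval y ≠ 0 ∧ ‖φ.num.eval y‖ ≤ ‖φ.denom.eval y‖ := by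
  have hle : ‖φ.num.eval y‖ ≤ ‖φ.denom.eval y‖ := by
    have hcl : IsClosed {y : ℂ | ‖φ.num.eval y‖ ≤ ‖φ.denom.eval y‖} :=
      isClosed_le (by fun_prop) (by fun_prop)
    have hsub : closure (Metric.ball (0 : ℂ) 1) ⊆ {y : ℂ | ‖φ.num.eval y‖ ≤ ‖φ.denom.eval y‖} :=
      closure_minimal (fun w hw => (hφ.denom_ne_zero hw).2.le) hcl
    rw [closure_ball 0 one_ne_zero] at hsub
    exact hsub (by simpa using hy)
  refine ⟨fun h => num_eval_ne_zero h ?_, hle⟩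
  rw [h, norm_zero] at hle
  exact norm_le_zero_iff.1 hle

theorem IsDiscSelfMap.onPlane_eq {φ : RatFunc ℂ} (hφ : IsDiscSelfMap φ)
    {y : ℂ} (hy : y ∈ Metric.ball (0 : ℂ) 1) :
    onPlane (toSphere φ) y = φ.num.eval y / φ.denom.eval y := by
  rw [onPlane, toSphere_pt, if_neg (hφ.denom_ne_zero hy).1]
  rfl

theorem IsDiscSelfMap.differentiableOn {φ : RatFunc ℂ} (hφ : IsDiscSelfMap φ) :
    DifferentiableOn ℂ (onPlane (toSphere φ)) (Metric.ball 0 1) := by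
  have : DifferentiableOn ℂ (fun y => φ.num.eval y / φ.denom.eval y) (Metric.ball 0 1) :=
    φ.num.differentiable.differentiableOn.div φ.denom.differentiable.differentiableOn
      fun y hy => (hφ.denom_ne_zero hy).1
  exact this.congr fun y hy => hφ.onPlane_eq hy

theorem IsDiscSelfMap.mapsTo {φ : RatFunc ℂ} (hφ : IsDiscSelfMap φ) :
    Set.MapsTo (onPlane (toSphere φ)) (Metric.ball 0 1) (Metric.ball 0 1) := by
  intro y hy
  obtain ⟨h1, h2⟩ := hφ.denom_ne_zero hy
  rw [hφ.onPlane_eq hy, Metric.mem_ball, dist_zero_right, norm_div, div_lt_one (norm_pos_iff.2 h1)]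
  exact h2

/-- The exterior map takes values in the disc only at points of the disc. -/
theorem IsDiscSelfMap.mem_disc_of_exterior {φ : RatFunc ℂ} (hφ : IsDiscSelfMap φ)
    {x : Sphere} {z : ℂ} (hz : z ∈ Metric.ball (0 : ℂ) 1)
    (h : exterior φ x = pt z) : x ∈ disc := by
  have hz' : ‖z‖ < 1 := by simpa using hz
  by_contra hx
  -- A point off the disc inverts into the closed disc, where |φ| ≤ 1. But φ would there take the
  -- value inverse to z, which is ∞ or has modulus > 1.
  obtain ⟨y, hy, hxy⟩ : ∃ y : ℂ, ‖y‖ ≤ 1 ∧ inversion x = pt y := by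
    induction x using OnePoint.rec with
    | infty => exact ⟨0, by simp, rfl⟩
    | coe s =>
      have hs : 1 ≤ ‖s‖ := by
        by_contra hs
        exact hx ⟨s, by simpa using hs, rfl⟩
      have hs0 : s ≠ 0 := fun h0 => by simp [h0] at hs; linarith
      refine ⟨1 / conj s, ?_, ?_⟩
      · rw [norm_div, norm_one, RCLike.norm_conj]
        exact (div_le_one (by linarith)).2 hs
      · change inversion (pt s) = _
        rw [inversion_pt, if_neg hs0]
  obtain ⟨h1, h2⟩ := hφ.norm_num_le hy
  have h3 : toSphere φ (pt y) = inversion (pt z) := by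
    rw [← h, ← hxy]
    exact (inversion_inversion _).symm
  rw [toSphere_pt, if_neg h1, inversion_pt] at h3
  split_ifs at h3 with h0
  · exact OnePoint.coe_ne_infty _ h3
  · have h4 := congrArg norm (OnePoint.coe_injective h3)
    rw [norm_div, norm_div, norm_one, RCLike.norm_conj, div_eq_div_iff (norm_ne_zero_iff.2 h1)
      (norm_ne_zero_iff.2 h0), one_mul] at h4
    have := norm_pos_iff.2 h1
    nlinarith [norm_nonneg z, norm_nonneg (φ.num.eval y)]

/-- The polynomial whose roots are the preimages of `z` under the exterior map has no zeros
outside the closed disc. -/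
theorem IsDiscSelfMap.eval_extNum_sub_ne_zero {φ : RatFunc ℂ} (hφ : IsDiscSelfMap φ)
    {w z : ℂ} (hw : w ∈ Metric.ball (0 : ℂ) 1) (hw0 : w ≠ 0) (hz : z ∈ Metric.ball (0 : ℂ) 1) :
    (extNum φ - C z * extDen φ).eval (conj w)⁻¹ ≠ 0 := by
  have hz' : ‖z‖ < 1 := by simpa using hz
  have hx : (conj w)⁻¹ ≠ 0 := by simpa using hw0
  intro h
  rw [eval_sub, eval_mul, eval_C, eval_extNum hx, eval_extDen hx] at h
  simp only [map_inv₀, Complex.conj_conj, inv_inv] at h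
  obtain ⟨h1, h2⟩ := hφ.denom_ne_zero hw
  have h3 : conj (φ.denom.eval w) = z * conj (φ.num.eval w) := by
    apply mul_left_cancel₀ (pow_ne_zero (degree φ) hx)
    linear_combination h
  have h4 := congrArg norm h3
  rw [norm_mul, RCLike.norm_conj, RCLike.norm_conj] at h4
  nlinarith [norm_nonneg z, norm_nonneg (φ.num.eval w)]

end RatComp

namespace RatComp

open ComplexConjugate Polynomial

/-! ### Partial fractions -/

section PartialFractions

variable {K ι : Type*} [Field K] [Fintype ι] {s : ι → K} {E : K[X]}

/-- The difference of the two sides loses its top coefficient, hence has fewer than n =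
`Fintype.card ι` possible roots, yet it vanishes at n points. -/
theorem exists_eq_C_mul_nodal (hs : Function.Injective s)
    (hE : E.natDegree ≤ Fintype.card ι) (hroot : ∀ i, E.eval (s i) = 0) :
    E = C (E.coeff (Fintype.card ι)) * Lagrange.nodal Finset.univ s := by
  refine eq_of_degree_sub_lt_of_eval_index_eq Finset.univ hs.injOn ?_ fun i hi => ?_
  · rw [Finset.card_univ, degree_lt_iff_coeff_zero]
    intro m hm
    have hn : (Lagrange.nodal Finset.univ s).natDegree = Fintype.card ι := by
      rw [Lagrange.natDegree_nodal, Finset.card_univ]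
    rw [coeff_sub, coeff_C_mul]
    rcases hm.eq_or_lt with rfl | hm
    · have h1 : (Lagrange.nodal Finset.univ s).coeff (Fintype.card ι) = 1 := by
        rw [← hn]
        exact Lagrange.nodal_monic
      rw [h1, mul_one, sub_self]
    · rw [coeff_eq_zero_of_natDegree_lt (hE.trans_lt hm),
        coeff_eq_zero_of_natDegree_lt (hn.trans_lt hm), mul_zero, sub_zero]
  · rw [hroot, eval_mul, Lagrange.eval_nodal_at_node hi, mul_zero]

/-- A nonzero polynomial with as many distinct roots as its degree bound has only simple roots. -/
theorem eval_derivative_ne_zero_of_roots (hs : Function.Injective s)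
    (hE : E.natDegree ≤ Fintype.card ι) (hE0 : E ≠ 0) (hroot : ∀ i, E.eval (s i) = 0) (i : ι) :
    (derivative E).eval (s i) ≠ 0 := by
  classical
  have h := exists_eq_C_mul_nodal hs hE hroot
  have hc : E.coeff (Fintype.card ι) ≠ 0 := by
    intro hc
    rw [hc, C_0, zero_mul] at h
    exact hE0 h
  rw [h, derivative_C_mul, eval_mul, eval_C,
    Lagrange.eval_nodal_derivative_eval_node_eq (Finset.mem_univ i), Lagrange.eval_nodal]
  refine mul_ne_zero hc (Finset.prod_ne_zero_iff.2 fun j hj => sub_ne_zero.2 fun hij => ?_)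
  exact (Finset.mem_erase.1 hj).1 (hs hij).symm

/-- Partial fraction expansion of `A / E` in the functions `x / (x - s i)`. -/
theorem eval_div_eq_partialFractions {A : K[X]} (hs : Function.Injective s)
    (hE : E.natDegree ≤ Fintype.card ι) (hE0 : E ≠ 0) (hroot : ∀ i, E.eval (s i) = 0)
    (hA : A.natDegree ≤ Fintype.card ι) (hs0 : ∀ i, s i ≠ 0) {x : K} (hx : x ≠ 0)
    (hEx : E.eval x ≠ 0) :
    A.eval x / E.eval x = A.eval 0 / E.eval 0 +
      ∑ i, A.eval (s i) / (s i * (derivative E).eval (s i)) * (x / (x - s i)) := by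
  classical
  have h := exists_eq_C_mul_nodal hs hE hroot
  set c := E.coeff (Fintype.card ι) with hcdef
  set N := Lagrange.nodal Finset.univ s with hN
  have hc : c ≠ 0 := by
    intro hc
    rw [hc, C_0, zero_mul] at h
    exact hE0 h
  have hxs : ∀ i, x ≠ s i := fun i hi => hEx (hi ▸ hroot i)
  have hNx : N.eval x ≠ 0 := by
    intro h0
    rw [h, eval_mul, h0, mul_zero] at hEx
    exact hEx rfl
  -- Adjoining 0 to the nodes gives one more node than the degree bound on A, so Lagrange
  -- interpolation at 0 and the s i recovers A exactly. Dividing by E gives the expansion.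
  set v : Option ι → K := fun o => o.elim 0 s with hv
  have hvinj : Function.Injective v := by
    rintro (_ | i) (_ | j) hij
    · rfl
    · exact absurd hij.symm (hs0 j)
    · exact absurd hij (hs0 i)
    · exact congrArg some (hs hij)
  have hnod : Lagrange.nodal Finset.univ v = X * N := by
    rw [Lagrange.nodal_eq, Fintype.prod_option, hN, Lagrange.nodal_eq]
    simp [hv]
  have hAdeg : A.degree < (Finset.univ : Finset (Option ι)).card := by
    rw [Finset.card_univ, Fintype.card_option]
    exact degree_le_natDegree.trans_lt (by exact_mod_cast Nat.lt_succ_of_le hA)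
  have hint := Lagrange.eq_interpolate hvinj.injOn hAdeg
  have hev := Lagrange.eval_interpolate_not_at_node (s := Finset.univ) (v := v)
    (fun i => A.eval (v i)) (x := x) (by
      rintro (_ | i) -
      · exact hx
      · exact hxs i)
  rw [← hint, hnod, Fintype.sum_option, Lagrange.nodalWeight_eq_eval_derivative_nodal
    (Finset.mem_univ none), hnod] at hev
  simp only [Lagrange.nodalWeight_eq_eval_derivative_nodal (Finset.mem_univ _), hnod] at hev
  have hNs : ∀ i, N.eval (s i) = 0 := fun i => Lagrange.eval_nodal_at_node (Finset.mem_univ i)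
  simp only [hv, Option.elim_none, Option.elim_some, derivative_mul, derivative_X, one_mul,
    eval_add, eval_mul, eval_X, zero_mul, add_zero, sub_zero, hNs, zero_add] at hev
  rw [hev, h]
  simp only [derivative_C_mul, eval_mul, eval_C]
  rw [mul_add, add_div, Finset.mul_sum, Finset.sum_div]
  congr 1
  · field_simp
  · refine Finset.sum_congr rfl fun i _ => ?_
    have := sub_ne_zero.2 (hxs i)
    have := hs0 i
    rw [mul_inv]
    field_simp

end PartialFractions

/-! ### The adjoint in terms of the roots of a polynomial -/

namespace H2

theorem adjoint_apply (T : H2 →L[ℂ] H2) (f : H2) {z : ℂ} (hz : z ∈ Metric.ball (0 : ℂ) 1) :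
    (ContinuousLinearMap.adjoint T f : H2) z = inner ℂ (T (kernel z)) f := by
  rw [← inner_kernel _ hz, ContinuousLinearMap.adjoint_inner_right]

end H2

/-- The kernel at 0 is the constant 1, which composition fixes. This covers z = 0 when φ(∞) = ∞,
where 0 is a root of E and the expansion is not available. -/
theorem IsDiscSelfMap.adjoint_apply_zero {φ : RatFunc ℂ} (hφ : IsDiscSelfMap φ) {T : H2 →L[ℂ] H2}
    (hT : IsCompositionOperator φ T) (f : H2) :
    (ContinuousLinearMap.adjoint T f : H2) 0 = f 0 := by
  have h0 : (0 : ℂ) ∈ Metric.ball (0 : ℂ) 1 := by simp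
  have : T (H2.kernel 0) = H2.kernel 0 := H2.ext_ball fun w hw => by
    rw [hT _ w hw, H2.kernel_apply h0 (hφ.mapsTo hw), H2.kernel_apply h0 hw, map_zero, zero_mul,
      zero_mul]
  rw [H2.adjoint_apply T f h0, this, H2.inner_kernel f h0]

theorem IsDiscSelfMap.extNum_sub_ne_zero {φ : RatFunc ℂ} (hφ : IsDiscSelfMap φ) {z : ℂ}
    (hz : z ∈ Metric.ball (0 : ℂ) 1) : extNum φ - C z * extDen φ ≠ 0 := by
  intro h
  have hw : (1 / 2 : ℂ) ∈ Metric.ball (0 : ℂ) 1 := by norm_num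
  refine hφ.eval_extNum_sub_ne_zero hw (by norm_num) hz ?_
  rw [h, eval_zero]

theorem natDegree_extNum_sub_le (φ : RatFunc ℂ) (z : ℂ) :
    (extNum φ - C z * extDen φ).natDegree ≤ degree φ :=
  (natDegree_sub_le _ _).trans
    (max_le (natDegree_extNum_le φ) ((natDegree_C_mul_le _ _).trans (natDegree_extDen_le φ)))

theorem IsDiscSelfMap.adjoint_apply_eq_sum {φ : RatFunc ℂ} (hφ : IsDiscSelfMap φ)
    {T : H2 →L[ℂ] H2} (hT : IsCompositionOperator φ T) (f : H2) {z : ℂ}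
    (hz : z ∈ Metric.ball (0 : ℂ) 1) {ι : Type*} [Fintype ι] (hι : Fintype.card ι = degree φ)
    {s : ι → ℂ} (hs : Function.Injective s) (hsb : ∀ i, s i ∈ Metric.ball (0 : ℂ) 1)
    (hs0 : ∀ i, s i ≠ 0) (hroot : ∀ i, (extNum φ - C z * extDen φ).eval (s i) = 0) :
    (ContinuousLinearMap.adjoint T f : H2) z =
      (extNum φ).eval 0 / (extNum φ - C z * extDen φ).eval 0 * f 0 +
        ∑ i, (extNum φ).eval (s i) /
          (s i * (derivative (extNum φ - C z * extDen φ)).eval (s i)) * f (s i) := by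
  have h0 : (0 : ℂ) ∈ Metric.ball (0 : ℂ) 1 := by simp
  set E := extNum φ - C z * extDen φ with hE
  set c₀ := (extNum φ).eval 0 / E.eval 0
  set r : ι → ℂ := fun i => (extNum φ).eval (s i) / (s i * (derivative E).eval (s i)) with hr
  have hker : T (H2.kernel z) =
      conj c₀ • H2.kernel 0 + ∑ i, conj (r i) • H2.kernel (s i) := by
    -- The point x = 1 / conj w exists only for w ≠ 0; continuity supplies w = 0.
    refine H2.ext_punctured fun w hw hw0 => ?_
    have hcw : conj w ≠ 0 := by simpa using hw0
    have hx : (conj w)⁻¹ ≠ 0 := inv_ne_zero hcw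
    have hEx := hφ.eval_extNum_sub_ne_zero hw hw0 hz
    have hpf := eval_div_eq_partialFractions (A := extNum φ) hs
      (hι ▸ natDegree_extNum_sub_le φ z) (hφ.extNum_sub_ne_zero hz) hroot
      (hι ▸ natDegree_extNum_le φ) hs0 hx hEx
    have hq := (hφ.denom_ne_zero hw).1
    have hL : T (H2.kernel z) w =
        conj ((extNum φ).eval (conj w)⁻¹ / E.eval (conj w)⁻¹) := by
      rw [hT _ w hw, H2.kernel_apply hz (hφ.mapsTo hw), hφ.onPlane_eq hw, hE, eval_sub, eval_mul,
        eval_C, eval_extNum hx, eval_extDen hx]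
      simp only [map_inv₀, Complex.conj_conj, inv_inv, map_div₀, map_sub, map_mul, map_pow]
      have hw' : w⁻¹ ^ degree φ ≠ 0 := pow_ne_zero _ (inv_ne_zero hw0)
      rw [mul_left_comm, ← mul_sub, mul_div_mul_left _ _ hw', ← mul_div_assoc, one_sub_div hq,
        one_div_div]
    rw [hL, hpf, H2.add_apply, H2.smul_apply, H2.sum_apply, H2.kernel_apply h0 hw, map_zero,
      zero_mul, sub_zero, div_one, mul_one, map_add, map_sum]
    congr 1
    refine Finset.sum_congr rfl fun i _ => ?_
    rw [H2.smul_apply, H2.kernel_apply (hsb i) hw, map_mul]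
    congr 1
    -- The conjugate of the right-hand side is the kernel at s i, evaluated at w.
    have : (conj w)⁻¹ / ((conj w)⁻¹ - s i) = 1 / (1 - s i * conj w) := by
      rw [← mul_div_mul_left ((conj w)⁻¹) _ hcw, mul_inv_cancel₀ hcw, mul_sub,
        mul_inv_cancel₀ hcw, mul_comm (conj w)]
    rw [this]
    simp
  rw [H2.adjoint_apply T f hz, hker, inner_add_left, sum_inner, inner_smul_left,
    Complex.conj_conj, H2.inner_kernel f h0]
  congr 1
  refine Finset.sum_congr rfl fun i _ => ?_
  rw [inner_smul_left, Complex.conj_conj, H2.inner_kernel f (hsb i)]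

/-! ### Branches of the inverse of the exterior map -/

open Topology

/-- Open mapping theorem: injectivity on an open set forbids local constancy. Branches are not
assumed continuous, and their continuity is drawn from here. -/
theorem eventually_exists_exterior_eq {φ : RatFunc ℂ} {V₁ : Set Sphere} (hV₁ : IsOpen V₁)
    (hinj : Set.InjOn (exterior φ) V₁) {s z : ℂ} (hs : pt s ∈ V₁)
    (hz : exterior φ (pt s) = pt z) {W : Set ℂ} (hW : W ∈ 𝓝 s) :
    ∀ᶠ y in 𝓝 z, ∃ t ∈ W, pt t ∈ V₁ ∧ exterior φ (pt t) = pt y := by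
  obtain ⟨hB, hAB⟩ := exterior_pt_eq_pt hz
  set g : ℂ → ℂ := fun t => (extNum φ).eval t / (extDen φ).eval t with hg
  have hga : AnalyticAt ℂ g s :=
    (extNum φ).differentiable.analyticAt s |>.div ((extDen φ).differentiable.analyticAt s) hB
  have hnear : ∀ᶠ t in 𝓝 s, pt t ∈ V₁ ∧ exterior φ (pt t) = pt (g t) := by
    have h1 : ∀ᶠ t in 𝓝 s, pt t ∈ V₁ :=
      (hV₁.preimage OnePoint.continuous_coe).mem_nhds hs
    have h2 : ∀ᶠ t in 𝓝 s, (extDen φ).eval t ≠ 0 :=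
      (extDen φ).continuous.continuousAt.eventually_ne hB
    filter_upwards [h1, h2] with t ht1 ht2
    exact ⟨ht1, by rw [exterior_pt, if_neg ht2]⟩
  rcases hga.eventually_constant_or_nhds_le_map_nhds with hconst | hopen
  · exfalso
    have h := ((hconst.and hnear).filter_mono (nhdsWithin_le_nhds (s := {s}ᶜ))).and
      self_mem_nhdsWithin
    obtain ⟨t, ⟨ht1, ht2, ht3⟩, hts⟩ := h.exists
    refine hts (OnePoint.coe_injective (hinj ht2 hs ?_))
    rw [ht3, ht1, hz]
    exact congrArg pt hAB
  · have hgs : g s = z := hAB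
    rw [hgs] at hopen
    have himg := hopen (Filter.image_mem_map (Filter.inter_mem hW hnear))
    filter_upwards [himg] with y hy
    obtain ⟨t, ⟨ht1, ht2, ht3⟩, rfl⟩ := hy
    exact ⟨t, ht1, ht2, ht3⟩

section Branch

variable {φ : RatFunc ℂ} {V : Set ℂ} {σ τ : Sphere → Sphere}

theorem IsBranch.exterior_apply (hσ : IsBranch (exterior φ) (pt '' V) σ) {z : ℂ} (hz : z ∈ V) :
    exterior φ (σ (pt z)) = pt z := by
  obtain ⟨V₁, -, -, h⟩ := hσ
  exact h.2 (Set.mem_image_of_mem pt hz)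

theorem IsBranch.mem_disc (hφ : IsDiscSelfMap φ) (hVb : V ⊆ Metric.ball 0 1)
    (hσ : IsBranch (exterior φ) (pt '' V) σ) {z : ℂ} (hz : z ∈ V) : σ (pt z) ∈ disc :=
  hφ.mem_disc_of_exterior (hVb hz) (hσ.exterior_apply hz)

theorem IsBranch.apply_eq_pt (hφ : IsDiscSelfMap φ) (hVb : V ⊆ Metric.ball 0 1)
    (hσ : IsBranch (exterior φ) (pt '' V) σ) {z : ℂ} (hz : z ∈ V) :
    σ (pt z) = pt (onPlane σ z) ∧ onPlane σ z ∈ Metric.ball (0 : ℂ) 1 := by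
  obtain ⟨s, hs, hs'⟩ := hσ.mem_disc hφ hVb hz
  have : onPlane σ z = s := by rw [onPlane, ← hs']; rfl
  rw [this]
  exact ⟨hs'.symm, hs⟩

/-- Near a point of its domain, a branch takes values near its value at that point. -/
theorem IsBranch.eventually_apply (hφ : IsDiscSelfMap φ) (hVb : V ⊆ Metric.ball 0 1)
    (hσ : IsBranch (exterior φ) (pt '' V) σ) {z : ℂ} (hz : z ∈ V) {W : Set ℂ}
    (hW : W ∈ 𝓝 (onPlane σ z)) :
    ∀ᶠ y in 𝓝 z, ∃ t ∈ W, σ (pt y) = pt t ∧ exterior φ (pt t) = pt y := by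
  have hval := (hσ.apply_eq_pt hφ hVb hz).1
  have hext := hσ.exterior_apply hz
  obtain ⟨V₁, hV₁, hbij, hinv⟩ := hσ
  have hmem : σ (pt z) ∈ V₁ := by
    obtain ⟨x, hx, hx'⟩ := hbij.surjOn (Set.mem_image_of_mem pt hz)
    rw [← hx', hinv.1 hx]
    exact hx
  rw [hval] at hmem hext
  filter_upwards [eventually_exists_exterior_eq hV₁ hbij.injOn hmem hext hW] with y hy
  obtain ⟨t, ht, htV, hty⟩ := hy
  exact ⟨t, ht, by rw [← hty, hinv.1 htV], hty⟩

theorem IsBranch.continuousAt (hφ : IsDiscSelfMap φ) (hVb : V ⊆ Metric.ball 0 1)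
    (hσ : IsBranch (exterior φ) (pt '' V) σ) {z : ℂ} (hz : z ∈ V) :
    ContinuousAt (onPlane σ) z := by
  intro W hW
  rw [Filter.mem_map]
  filter_upwards [hσ.eventually_apply hφ hVb hz hW] with y hy
  obtain ⟨t, ht, hty, -⟩ := hy
  rw [Set.mem_preimage, onPlane, hty]
  exact ht

/-- Near z the values of σ stay in the open set on which τ inverts φₑ, so τ must return the same
preimage. -/
theorem IsBranch.eventually_eq (hφ : IsDiscSelfMap φ) (hVb : V ⊆ Metric.ball 0 1)
    (hσ : IsBranch (exterior φ) (pt '' V) σ) (hτ : IsBranch (exterior φ) (pt '' V) τ) {z : ℂ}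
    (hz : z ∈ V) (h : σ (pt z) = τ (pt z)) : ∀ᶠ y in 𝓝 z, σ (pt y) = τ (pt y) := by
  have hval := (hτ.apply_eq_pt hφ hVb hz).1
  obtain ⟨V₂, hV₂, hbij, hinv⟩ := hτ
  have hmem : pt (onPlane σ z) ∈ V₂ := by
    rw [← (hσ.apply_eq_pt hφ hVb hz).1, h]
    obtain ⟨x, hx, hx'⟩ := hbij.surjOn (Set.mem_image_of_mem pt hz)
    rw [← hx', hinv.1 hx]
    exact hx
  filter_upwards [hσ.eventually_apply hφ hVb hz
    ((hV₂.preimage OnePoint.continuous_coe).mem_nhds hmem)] with y hy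
  obtain ⟨t, ht, hty, hext⟩ := hy
  rw [hty, ← hext]
  exact (hinv.1 ht).symm

/-- Two branches on a connected open set that agree at one point agree everywhere. -/
theorem IsBranch.eqOn (hφ : IsDiscSelfMap φ) (hVb : V ⊆ Metric.ball 0 1)
    (hV : IsPreconnected V) (hVo : IsOpen V)
    (hσ : IsBranch (exterior φ) (pt '' V) σ) (hτ : IsBranch (exterior φ) (pt '' V) τ) {z : ℂ}
    (hz : z ∈ V) (h : σ (pt z) = τ (pt z)) : Set.EqOn σ τ (pt '' V) := by
  -- Agreement is open by `eventually_eq`, disagreement by continuity; connectedness leaves only one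
  -- of them.
  set P : Set ℂ := {y | y ∈ V ∧ σ (pt y) = τ (pt y)}
  set Q : Set ℂ := {y | y ∈ V ∧ σ (pt y) ≠ τ (pt y)}
  have hP : IsOpen P := isOpen_iff_mem_nhds.2 fun y hy =>
    (Filter.inter_mem (hVo.mem_nhds hy.1) (hσ.eventually_eq hφ hVb hτ hy.1 hy.2) :)
  have hQ : IsOpen Q := isOpen_iff_mem_nhds.2 fun y hy => by
    have h1 := (hσ.apply_eq_pt hφ hVb hy.1).1
    have h2 := (hτ.apply_eq_pt hφ hVb hy.1).1
    have hne : onPlane σ y ≠ onPlane τ y := fun he => hy.2 (by rw [h1, h2, he])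
    have hcont := (hσ.continuousAt hφ hVb hy.1).prodMk (hτ.continuousAt hφ hVb hy.1)
    have := hcont.eventually (isOpen_ne_fun continuous_fst continuous_snd |>.mem_nhds hne)
    filter_upwards [this, hVo.mem_nhds hy.1] with x hx hxV
    exact ⟨hxV, fun he => hx (by simp only [onPlane, he])⟩
  rintro _ ⟨y, hy, rfl⟩
  by_contra hne
  obtain ⟨x, -, hx1, hx2⟩ := hV P Q hP hQ
    (fun x hx => by
      by_cases hx' : σ (pt x) = τ (pt x)
      · exact Or.inl ⟨hx, hx'⟩
      · exact Or.inr ⟨hx, hx'⟩) ⟨z, hz, hz, h⟩ ⟨y, hy, hy, hne⟩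
  exact hx2.2 hx1.2

theorem IsBranch.eval_eq_zero (hφ : IsDiscSelfMap φ) (hVb : V ⊆ Metric.ball 0 1)
    (hσ : IsBranch (exterior φ) (pt '' V) σ) {z : ℂ} (hz : z ∈ V) :
    (extDen φ).eval (onPlane σ z) ≠ 0 ∧
      (extNum φ).eval (onPlane σ z) = z * (extDen φ).eval (onPlane σ z) := by
  have h := hσ.exterior_apply hz
  rw [(hσ.apply_eq_pt hφ hVb hz).1] at h
  obtain ⟨h1, h2⟩ := exterior_pt_eq_pt h
  exact ⟨h1, (div_eq_iff h1).1 h2⟩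

/-- At s = σ(z) one has A = zB, so the quotient rule gives (A/B)' = E'/B, and a continuous local
inverse has the reciprocal derivative. -/
theorem IsBranch.hasDerivAt (hφ : IsDiscSelfMap φ) (hVb : V ⊆ Metric.ball 0 1) (hVo : IsOpen V)
    (hσ : IsBranch (exterior φ) (pt '' V) σ) {z : ℂ} (hz : z ∈ V)
    (hE : (derivative (extNum φ - C z * extDen φ)).eval (onPlane σ z) ≠ 0) :
    HasDerivAt (onPlane σ) ((extDen φ).eval (onPlane σ z) /
      (derivative (extNum φ - C z * extDen φ)).eval (onPlane σ z)) z := by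
  obtain ⟨hB, hA⟩ := hσ.eval_eq_zero hφ hVb hz
  have hd := ((extNum φ).hasDerivAt (onPlane σ z)).fun_div ((extDen φ).hasDerivAt (onPlane σ z)) hB
  have hd' : HasDerivAt (fun t => (extNum φ).eval t / (extDen φ).eval t)
      ((derivative (extNum φ - C z * extDen φ)).eval (onPlane σ z) /
        (extDen φ).eval (onPlane σ z)) (onPlane σ z) := by
    refine hd.congr_deriv ?_
    rw [hA, derivative_sub, derivative_C_mul, eval_sub, eval_mul, eval_C]
    field_simp
  have := hd'.of_local_left_inverse (hσ.continuousAt hφ hVb hz) (div_ne_zero hE hB) (by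
    filter_upwards [hVo.mem_nhds hz] with y hy
    obtain ⟨h1, h2⟩ := hσ.eval_eq_zero hφ hVb hy
    exact (div_eq_iff h1).2 h2)
  rwa [inv_div] at this

end Branch

end RatComp

/-! ### The adjoint formula -/

theorem theorem2p1 (φ : RatFunc ℂ) (hφ : RatComp.IsDiscSelfMap φ)
    (d : ℕ) (hd : 0 < d) (hdeg : RatComp.degree φ = d) :
    ∃ C : RatComp.H2 →L[ℂ] RatComp.H2, RatComp.IsCompositionOperator φ C ∧
      ∀ (f : RatComp.H2) (z₀ : ℂ) (V : Set ℂ) (σ : Fin d → RatComp.Sphere → RatComp.Sphere),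
        z₀ ∈ Metric.ball (0 : ℂ) 1 →
        RatComp.IsRegularValue (RatComp.exterior φ) (RatComp.pt z₀) →
        V ⊆ Metric.ball (0 : ℂ) 1 → IsOpen V → IsConnected V → z₀ ∈ V →
        (∀ j, RatComp.IsBranch (RatComp.exterior φ) (RatComp.pt '' V) (σ j)) →
        (∀ i j, i ≠ j → ¬ Set.EqOn (σ i) (σ j) (RatComp.pt '' V)) →
        (∀ j, ∀ z ∈ V, σ j (RatComp.pt z) ∈ RatComp.disc) ∧
        (∀ j, DifferentiableOn ℂ (RatComp.onPlane (σ j)) V) ∧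
        (∀ c : ℂ, RatComp.toSphere φ OnePoint.infty = RatComp.pt c →
          ∀ z ∈ V, RatComp.pt z ≠ RatComp.inversion (RatComp.pt c) →
            1 - (starRingEnd ℂ) c * z ≠ 0 ∧ (∀ j, RatComp.onPlane (σ j) z ≠ 0) ∧
            (ContinuousLinearMap.adjoint C f : RatComp.H2) z =
              f 0 / (1 - (starRingEnd ℂ) c * z) +
                z * ∑ j, deriv (RatComp.onPlane (σ j)) z / RatComp.onPlane (σ j) z *
                  f (RatComp.onPlane (σ j) z)) ∧
        (RatComp.toSphere φ OnePoint.infty = OnePoint.infty →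
          ∀ z ∈ V,
            (z ≠ 0 → (∀ j, RatComp.onPlane (σ j) z ≠ 0) ∧
              (ContinuousLinearMap.adjoint C f : RatComp.H2) z =
                z * ∑ j, deriv (RatComp.onPlane (σ j)) z / RatComp.onPlane (σ j) z *
                  f (RatComp.onPlane (σ j) z)) ∧
            (z = 0 → (ContinuousLinearMap.adjoint C f : RatComp.H2) z = f 0)) := by
  obtain ⟨C, hC⟩ := RatComp.exists_compositionOperator hφ.differentiableOn hφ.mapsTo
  refine ⟨C, hC, ?_⟩
  intro f z₀ V σ _ _ hVb hVo hVc _ hσ hdist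
  have hcard : Fintype.card (Fin d) = RatComp.degree φ := by rw [Fintype.card_fin, hdeg]
  have hval := fun j z (hz : z ∈ V) => (hσ j).apply_eq_pt hφ hVb hz
  -- Distinct branches on a connected set never meet, so they give d distinct roots of E at every
  -- point of V, not just at z₀.
  have hinj : ∀ z ∈ V, Function.Injective fun j => RatComp.onPlane (σ j) z := by
    intro z hz i j hij
    by_contra hne
    refine hdist i j hne ((hσ i).eqOn hφ hVb hVc.isPreconnected hVo (hσ j) hz ?_)
    rw [(hval i z hz).1, (hval j z hz).1]
    exact congrArg RatComp.pt hij
  have hroot : ∀ z ∈ V, ∀ j, (RatComp.extNum φ - Polynomial.C z * RatComp.extDen φ).eval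
      (RatComp.onPlane (σ j) z) = 0 := by
    intro z hz j
    rw [Polynomial.eval_sub, Polynomial.eval_mul, Polynomial.eval_C,
      ((hσ j).eval_eq_zero hφ hVb hz).2, sub_self]
  have hder : ∀ z ∈ V, ∀ j, (Polynomial.derivative
      (RatComp.extNum φ - Polynomial.C z * RatComp.extDen φ)).eval
        (RatComp.onPlane (σ j) z) ≠ 0 := fun z hz j =>
    RatComp.eval_derivative_ne_zero_of_roots (hinj z hz)
      (hcard ▸ RatComp.natDegree_extNum_sub_le φ z) (hφ.extNum_sub_ne_zero (hVb hz)) (hroot z hz) j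
  have hderiv := fun j z (hz : z ∈ V) => (hσ j).hasDerivAt hφ hVb hVo hz (hder z hz j)
  -- E(0) ≠ 0 says that 0 is not a preimage of z, so no σ_j(z) vanishes.
  have hmain : ∀ z ∈ V,
      (RatComp.extNum φ - Polynomial.C z * RatComp.extDen φ).eval 0 ≠ 0 →
      (∀ j, RatComp.onPlane (σ j) z ≠ 0) ∧
      (ContinuousLinearMap.adjoint C f : RatComp.H2) z =
        (RatComp.extNum φ).eval 0 /
          (RatComp.extNum φ - Polynomial.C z * RatComp.extDen φ).eval 0 * f 0 +
        z * ∑ j, deriv (RatComp.onPlane (σ j)) z / RatComp.onPlane (σ j) z *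
          f (RatComp.onPlane (σ j) z) := by
    intro z hz h0
    have hs0 : ∀ j, RatComp.onPlane (σ j) z ≠ 0 := fun j hj => h0 (hj ▸ hroot z hz j)
    refine ⟨hs0, ?_⟩
    rw [hφ.adjoint_apply_eq_sum hC f (hVb hz) hcard (hinj z hz) (fun j => (hval j z hz).2) hs0
      (hroot z hz), Finset.mul_sum]
    congr 1
    refine Finset.sum_congr rfl fun j _ => ?_
    -- A(s_j) = z B(s_j) turns the partial fraction coefficient into z σ_j'/σ_j.
    rw [(hderiv j z hz).deriv, ((hσ j).eval_eq_zero hφ hVb hz).2]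
    have := hs0 j
    have := hder z hz j
    field_simp
  have hnum0 : (RatComp.extNum φ).eval 0 =
      (starRingEnd ℂ) (φ.denom.coeff (RatComp.degree φ)) :=
    RatComp.eval_zero_reflect_map_conj _ _
  have hden0 : (RatComp.extDen φ).eval 0 =
      (starRingEnd ℂ) (φ.num.coeff (RatComp.degree φ)) :=
    RatComp.eval_zero_reflect_map_conj _ _
  refine ⟨fun j z hz => (hσ j).mem_disc hφ hVb hz,
    fun j z hz => (hderiv j z hz).differentiableAt.differentiableWithinAt, ?_, ?_⟩
  · intro c hc z hz hne
    obtain ⟨h1, h2⟩ := RatComp.toSphere_infty_eq_pt hc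
    have hE : (RatComp.extNum φ - Polynomial.C z * RatComp.extDen φ).eval 0 =
        1 - (starRingEnd ℂ) c * z := by
      rw [Polynomial.eval_sub, Polynomial.eval_mul, Polynomial.eval_C, hnum0, hden0, h1, h2,
        map_one, mul_comm]
    have h0 : 1 - (starRingEnd ℂ) c * z ≠ 0 := by
      intro h0
      have hcz := sub_eq_zero.1 h0
      have hc0 : (starRingEnd ℂ) c ≠ 0 := left_ne_zero_of_mul (hcz ▸ one_ne_zero)
      refine hne ?_
      rw [RatComp.inversion_pt, if_neg (by simpa using hc0), hcz, mul_div_cancel_left₀ _ hc0]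
    obtain ⟨hs0, hsum⟩ := hmain z hz (hE ▸ h0)
    refine ⟨h0, hs0, ?_⟩
    rw [hsum, hE, hnum0, h1, map_one, one_div_mul_eq_div]
  · intro hinf z hz
    obtain ⟨h1, h2⟩ := RatComp.toSphere_infty_eq_infty hinf
    refine ⟨fun hz0 => ?_, fun hz0 => ?_⟩
    -- Here A(0) = 0 and B(0) ≠ 0, so E(0) = -z B(0) and the f(0) term drops out.
    · have hE : (RatComp.extNum φ - Polynomial.C z * RatComp.extDen φ).eval 0 ≠ 0 := by
        rw [Polynomial.eval_sub, Polynomial.eval_mul, Polynomial.eval_C, hnum0, hden0, h1, map_zero,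
          zero_sub]
        exact neg_ne_zero.2 (mul_ne_zero hz0 (by simpa using h2))
      obtain ⟨hs0, hsum⟩ := hmain z hz hE
      refine ⟨hs0, ?_⟩
      rw [hsum, hnum0, h1, map_zero, zero_div, zero_mul, zero_add]
    · rw [hz0]
      exact hφ.adjoint_apply_zero hC f
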